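/- Let $\mathcal H=L^2(\mathbb R;\mathbb C)$ be the Hilbert space of one continuous-variable mode, with position operator $(\boldsymbol q\psi)(y)=y\,\psi(y)$ and momentum operator $\boldsymbol p=-i\,\frac{d}{dy}$, and for $(\mu,\nu)\in\mathbb R^2\setminus\{(0,0)\}$ let $\boldsymbol X_{\mu,\nu}=\mu\boldsymbol q+\nu\boldsymbol p$ be the corresponding quadrature. For a density operator $\boldsymbol\rho$ on $\mathcal H$ (positive semidefinite with $\operatorname{tr}\boldsymbol\rho=1$), its symplectic tomogram $\mathcal W(\cdot|\mu,\nu)$ is the probability density of $\boldsymbol X_{\mu,\nu}$ in the state $\boldsymbol\rho$, formally $\mathcal W(x|\mu,\nu)=\operatorname{tr}[\boldsymbol\rho\,\delta(x\hat 1-\boldsymbol X_{\mu,\nu})]$ with $\delta(\boldsymbol A)=\frac1{2\pi}\int e^{ik\boldsymbol A}\,dk$; that is, it is the nonnegative integrable function (unique up to null sets) with $$\int_{\mathbb R} e^{itx}\,\mathcal W(x|\mu,\nu)\,dx=\operatorname{tr}\bigl(\boldsymbol\rho\,e^{it\boldsymbol X_{\mu,\nu}}\bigr)\qquad\text{for all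 }t\in\mathbb R.$$ Theorem. Let $\boldsymbol\rho_1,\boldsymbol\rho_2$ be any two density operators on $\mathcal H$ and let $(\mu,\nu)\neq(0,0)$. Then the tomograms $\mathcal W_1(\cdot|\mu,\nu)$ and $\mathcal W_2(\cdot|\mu,\nu)$ exist, $\|\boldsymbol\rho_1-\boldsymbol\rho_2\|_1=\operatorname{tr}|\boldsymbol\rho_1-\boldsymbol\rho_2|<\infty$, and the total variation distance of the tomograms is at most the trace distance of the states: $$\frac12\int_{\mathbb R}\bigl|\mathcal W_1(x|\mu,\nu)-\mathcal W_2(x|\mu,\nu)\bigr|\,dx\;\le\;\frac12\,\|\boldsymbol\rho_1-\boldsymbol\rho_2\|_1 .$$ -/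

import Mathlib

open MeasureTheory
open scoped ENNReal InnerProductSpace

noncomputable section

namespace CVTomography

/-! ### Trace, density operators, trace distance -/

section Trace

variable (E : Type*) [NormedAddCommGroup E] [InnerProductSpace ℂ E] [CompleteSpace E]

/-- The index set of a fixed orthonormal basis of `E`. -/
def basisIndex : Set E := (exists_hilbertBasis ℂ E).choose

/-- A fixed orthonormal basis of the Hilbert space `E`, in which traces are computed. (The traces
of positive operators and of trace class operators do not depend on this choice.) -/
def onb : HilbertBasis (basisIndex E) ℂ E := (exists_hilbertBasis ℂ E).choose_spec.choose

variable {E}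

/-- The trace `tr A = ∑ᵢ ⟨eᵢ, A eᵢ⟩` of a trace class operator. -/
def trace (A : E →L[ℂ] E) : ℂ := ∑' i, ⟪onb E i, A (onb E i)⟫_ℂ

/-- A density operator: Hermitian, positive semidefinite and of unit trace (the last clause says
that the trace series converges, with sum `1`). -/
def IsDensityOperator (ρ : E →L[ℂ] E) : Prop :=
  ρ.IsPositive ∧ HasSum (fun i => ⟪onb E i, ρ (onb E i)⟫_ℂ) 1

/-- The trace norm `‖A‖₁ = tr |A| = ∑ᵢ ⟨eᵢ, |A| eᵢ⟩`, where `|A| = √(A* A)`, as an element of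
`[0, ∞]`. -/
def traceNorm (A : E →L[ℂ] E) : ℝ≥0∞ :=
  ∑' i, ENNReal.ofReal (⟪onb E i, CFC.abs A (onb E i)⟫_ℂ).re

/-- The trace distance `D(ρ₁, ρ₂) = ½ ‖ρ₁ - ρ₂‖₁`. -/
def traceDistance (ρ₁ ρ₂ : E →L[ℂ] E) : ℝ := (1 / 2) * (traceNorm (ρ₁ - ρ₂)).toReal

end Trace

/-- The Hilbert space `L²(ℝ; ℂ)` of one continuous-variable mode (Schrödinger representation). -/
abbrev H : Type := Lp ℂ 2 (volume : Measure ℝ)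

/-! ### The quadrature `X = μ q + ν p` and the unitary group `e^{i t X}`

Here `(q ψ)(y) = y ψ(y)` and `p = -i d/dy`, so that `[q, p] = i`. -/

/-- The action of `μ q + ν p` on (differentiable) wave functions. -/
def quadratureFun (μ ν : ℝ) (f : ℝ → ℂ) (y : ℝ) : ℂ :=
  (μ : ℂ) * ((y : ℂ) * f y) + (ν : ℂ) * (-Complex.I * deriv f y)

/-- The phase factor `exp (i (t μ y + t² μ ν / 2))`. -/
def phase (μ ν t y : ℝ) : ℂ := Complex.exp (((t * μ * y + t ^ 2 * μ * ν / 2 : ℝ) : ℂ) * Complex.I)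

/-- `(e^{i t (μ q + ν p)} f)(y) = exp (i (t μ y + t² μ ν / 2)) f(y + t ν)`, on functions. -/
def expQuadratureFun (μ ν t : ℝ) (f : ℝ → ℂ) (y : ℝ) : ℂ := phase μ ν t y * f (y + t * ν)

theorem expQuadratureFun_zero (μ ν : ℝ) (f : ℝ → ℂ) : expQuadratureFun μ ν 0 f = f := by
  funext y; simp [expQuadratureFun, phase]

theorem expQuadratureFun_add (μ ν s t : ℝ) (f : ℝ → ℂ) :
    expQuadratureFun μ ν (s + t) f = expQuadratureFun μ ν s (expQuadratureFun μ ν t f) := by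
  funext y
  simp only [expQuadratureFun, phase, ← mul_assoc, ← Complex.exp_add]
  congr 1
  · congr 1; push_cast; ring
  · congr 1; ring

/-- The group solves `∂ₜ u = i (μ q + ν p) u` with `u(0) = f`: its generator is `i X`. -/
theorem hasDerivAt_expQuadratureFun (μ ν t : ℝ) (f : ℝ → ℂ) (hf : Differentiable ℝ f) (y : ℝ) :
    HasDerivAt (fun s => expQuadratureFun μ ν s f y)
      (Complex.I * quadratureFun μ ν (expQuadratureFun μ ν t f) y) t := by
  have key : ∀ (a b : ℝ → ℝ) (a' b' r : ℝ), HasDerivAt a a' r → HasDerivAt b b' r →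
      HasDerivAt (fun s => Complex.exp ((a s : ℂ) * Complex.I) * f (b s))
        (Complex.exp ((a r : ℂ) * Complex.I) * (a' * Complex.I) * f (b r)
          + Complex.exp ((a r : ℂ) * Complex.I) * (b' * deriv f (b r))) r := by
    intro a b a' b' r ha hb
    have h2 : HasDerivAt (fun s => f (b s)) (b' * deriv f (b r)) r := by
      have h3 := (hf (b r)).hasDerivAt.scomp r hb
      rw [Complex.real_smul] at h3
      exact h3
    exact ((ha.ofReal_comp.mul_const Complex.I).cexp).mul h2
  have hy : HasDerivAt (expQuadratureFun μ ν t f) _ y :=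
    key (fun z => t * μ * z + t ^ 2 * μ * ν / 2) (fun z => z + t * ν) (t * μ) 1 y
      (by simpa using ((hasDerivAt_id' y).const_mul (t * μ)).add_const (t ^ 2 * μ * ν / 2))
      ((hasDerivAt_id' y).add_const _)
  have ht := key (fun s => s * μ * y + s ^ 2 * μ * ν / 2) (fun s => y + s * ν)
      (μ * y + t * μ * ν) ν t
      (by
        have h1 := ((hasDerivAt_id' t).mul_const (μ * y)).add
          ((hasDerivAt_pow 2 t).mul_const (μ * ν / 2))
        refine (h1.congr_deriv ?_).congr_of_eventuallyEq ?_
        · push_cast; ring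
        · exact Filter.Eventually.of_forall fun s => by simp only [Pi.add_apply]; ring)
      (by simpa using ((hasDerivAt_id' t).mul_const ν).const_add y)
  refine ht.congr_deriv ?_
  rw [quadratureFun, hy.deriv]
  simp only [expQuadratureFun, phase]
  push_cast
  linear_combination (ν * Complex.exp ((t * μ * y + t ^ 2 * μ * ν / 2) * Complex.I) *
    (t * μ * Complex.I * f (y + t * ν) + deriv f (y + t * ν))) * Complex.I_sq

theorem norm_phase (μ ν t y : ℝ) : ‖phase μ ν t y‖ = 1 := Complex.norm_exp_ofReal_mul_I _

theorem continuous_phase (μ ν t : ℝ) : Continuous (phase μ ν t) := by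
  unfold phase; fun_prop

theorem measurePreserving_shift (c : ℝ) :
    MeasurePreserving (fun y : ℝ => y + c) volume volume :=
  measurePreserving_add_right volume c

theorem memLp_expQuadratureFun (μ ν t : ℝ) (ψ : H) :
    MemLp (expQuadratureFun μ ν t ψ) 2 (volume : Measure ℝ) := by
  have h : MemLp (fun y => ψ (y + t * ν)) 2 (volume : Measure ℝ) :=
    (Lp.memLp ψ).comp_measurePreserving (measurePreserving_shift (t * ν))
  refine h.of_le ((continuous_phase μ ν t).aestronglyMeasurable.mul h.1) ?_
  exact Filter.Eventually.of_forall fun y => by simp [expQuadratureFun, norm_phase]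

theorem expQuadratureFun_congr (μ ν t : ℝ) {f g : ℝ → ℂ} (h : f =ᵐ[volume] g) :
    expQuadratureFun μ ν t f =ᵐ[volume] expQuadratureFun μ ν t g := by
  filter_upwards [(measurePreserving_shift (t * ν)).quasiMeasurePreserving.ae h] with y hy
  simp [expQuadratureFun, hy]

/-- The unitary operator `e^{i t (μ q + ν p)}` on `L²(ℝ; ℂ)`. -/
def expQuadrature (μ ν t : ℝ) : H →L[ℂ] H :=
  LinearMap.mkContinuous
    { toFun := fun ψ => (memLp_expQuadratureFun μ ν t ψ).toLp _
      map_add' := fun ψ χ => by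
        rw [← MemLp.toLp_add, MemLp.toLp_eq_toLp_iff]
        refine (expQuadratureFun_congr μ ν t (Lp.coeFn_add ψ χ)).trans ?_
        exact Filter.Eventually.of_forall fun y => by simp [expQuadratureFun, mul_add]
      map_smul' := fun c ψ => by
        rw [RingHom.id_apply, ← MemLp.toLp_const_smul, MemLp.toLp_eq_toLp_iff]
        refine (expQuadratureFun_congr μ ν t (Lp.coeFn_smul c ψ)).trans ?_
        exact Filter.Eventually.of_forall fun y => by
          simp [expQuadratureFun, mul_left_comm] }
    1 (fun ψ => by
      rw [one_mul, LinearMap.coe_mk, AddHom.coe_mk, Lp.norm_toLp, Lp.norm_def]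
      refine ENNReal.toReal_mono (Lp.eLpNorm_ne_top ψ) ?_
      rw [← eLpNorm_comp_measurePreserving (Lp.aestronglyMeasurable ψ)
        (measurePreserving_shift (t * ν))]
      refine eLpNorm_mono fun y => ?_
      simp [expQuadratureFun, norm_phase])

/-! ### Symplectic tomograms -/

/-- `w` is the probability density of the quadrature `X = μ q + ν p` in the state `ρ`, i.e.
`w(x) = tr (ρ δ(x - X))` with `δ(A) = (2π)⁻¹ ∫ e^{i k A} dk`. In general this integral over `k`
exists only in the sense of Fourier inversion, which says that `w` is the integrable function with
`∫ e^{i t x} w(x) dx = tr (ρ e^{i t X})` for all `t`; this determines `w` almost everywhere. -/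
def IsTomogram (ρ : H →L[ℂ] H) (μ ν : ℝ) (w : ℝ → ℝ) : Prop :=
  (∀ x, 0 ≤ w x) ∧ Integrable w ∧
    ∀ t : ℝ, ∫ x, Complex.exp (((t * x : ℝ) : ℂ) * Complex.I) * (w x : ℂ)
      = trace (ρ ∘L expQuadrature μ ν t)

open Classical in
/-- The symplectic tomogram `𝒲(· | μ, ν)` of `ρ`, as a function of `x` (determined up to null
sets). -/
def tomogram (ρ : H →L[ℂ] H) (μ ν : ℝ) : ℝ → ℝ :=
  if h : ∃ w, IsTomogram ρ μ ν w then h.choose else 0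

/-- The total variation distance `½ ∫ |w₁ - w₂| dx` of two densities. -/
def totalVariation (w₁ w₂ : ℝ → ℝ) : ℝ := (1 / 2) * ∫ x, |w₁ x - w₂ x|

end CVTomography

end

open MeasureTheory
open scoped ENNReal InnerProductSpace

/-! Write `ρ₁ - ρ₂ = P - N` with `P`, `N` the positive and negative parts, so that `P + N = |ρ₁ -
ρ₂|`. If `v`, `u` are tomograms of `P`, `N`, then `ρ₁ + N = ρ₂ + P` gives `w₁ + u = w₂ + v` almost
everywhere, because tomograms are additive and determined by their Fourier transforms
(`IsTomogram.add`, `IsTomogram.ae_eq`). Hence `|w₁ - w₂| = |v - u| ≤ v + u`, whose integral is `tr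
(P + N)`; this is `integral_abs_sub_le`.

Existence: with `ψᵢ = √ρ bᵢ`, cyclicity of the trace gives `tr (ρ B) = ∑ ⟨ψᵢ, B ψᵢ⟩`
(`exists_vectors`), so it suffices to sum densities of vector states. `exists_density` gets these
from `|ψ|²` when `ν = 0`, and otherwise from a gauge transformation followed by the Fourier
transform.

Finiteness of the trace norm: `|A|` is a norm limit of operators `A B` with `‖B‖ ≤ 1`, and `|tr (ρ
B)| ≤ ‖B‖ tr ρ` bounds the partial sums (`isPositiveTraceClass_abs_sub`). -/

namespace CVTomography

/-! ### Hilbert-Schmidt operators and cyclicity of the trace. -/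

section HilbertSchmidt

variable {E ι : Type*} [NormedAddCommGroup E] [InnerProductSpace ℂ E] [CompleteSpace E]

/-- The Hilbert-Schmidt condition `∑ᵢ ‖S bᵢ‖² < ∞` with respect to a Hilbert basis. -/
def IsHilbertSchmidt (b : HilbertBasis ι ℂ E) (S : E →L[ℂ] E) : Prop :=
  Summable fun i => ‖S (b i)‖ ^ 2

omit [CompleteSpace E] in
theorem hasSum_norm_inner_sq (b : HilbertBasis ι ℂ E) (x : E) :
    HasSum (fun i => ‖⟪b i, x⟫_ℂ‖ ^ 2) (‖x‖ ^ 2) := by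
  have h := (Complex.hasSum_iff _ _).1 (b.hasSum_inner_mul_inner x x) |>.1
  have h2 : (⟪x, x⟫_ℂ).re = ‖x‖ ^ 2 := inner_self_eq_norm_sq (𝕜 := ℂ) x
  rw [h2] at h
  convert h using 2 with i
  rw [← inner_conj_symm x (b i), ← Complex.normSq_eq_conj_mul_self, Complex.ofReal_re,
    Complex.normSq_eq_norm_sq]

namespace IsHilbertSchmidt

variable {b : HilbertBasis ι ℂ E} {S T : E →L[ℂ] E}

omit [CompleteSpace E] in
theorem summable_norm_inner_sq (hS : IsHilbertSchmidt b S) :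
    Summable fun p : ι × ι => ‖⟪b p.2, S (b p.1)⟫_ℂ‖ ^ 2 := by
  rw [summable_prod_of_nonneg fun p => by positivity]
  refine ⟨fun i => (hasSum_norm_inner_sq b (S (b i))).summable, ?_⟩
  simpa only [(hasSum_norm_inner_sq b _).tsum_eq, IsHilbertSchmidt] using hS

/-- Swapping the two indices in the double sum of squared matrix entries turns `S` into its adjoint.
-/
theorem adjoint (hS : IsHilbertSchmidt b S) : IsHilbertSchmidt b (S.adjoint) := by
  have h := ((summable_prod_of_nonneg fun p => by positivity).1
    hS.summable_norm_inner_sq.prod_symm).2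
  refine h.congr fun i => ?_
  rw [← (hasSum_norm_inner_sq b _).tsum_eq]
  refine tsum_congr fun j => ?_
  rw [ContinuousLinearMap.adjoint_inner_right, norm_inner_symm]
  rfl

omit [CompleteSpace E] in
theorem comp_left (hS : IsHilbertSchmidt b S) (B : E →L[ℂ] E) : IsHilbertSchmidt b (B ∘L S) := by
  refine Summable.of_nonneg_of_le (fun i => by positivity) (fun i => ?_)
    (Summable.mul_left (‖B‖ ^ 2) hS)
  rw [← mul_pow]
  gcongr
  exact B.le_opNorm _

theorem comp_right (hS : IsHilbertSchmidt b S) (B : E →L[ℂ] E) :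
    IsHilbertSchmidt b (S ∘L B) := by
  have h := (hS.adjoint.comp_left B.adjoint).adjoint
  rwa [← ContinuousLinearMap.adjoint_comp, ContinuousLinearMap.adjoint_adjoint] at h

omit [CompleteSpace E] in
theorem summable_inner_mul_inner (hS : IsHilbertSchmidt b S) (hT : IsHilbertSchmidt b T) :
    Summable fun p : ι × ι => ⟪S (b p.1), b p.2⟫_ℂ * ⟪b p.2, T (b p.1)⟫_ℂ := by
  refine Summable.of_norm_bounded (hS.summable_norm_inner_sq.add hT.summable_norm_inner_sq)
    fun p => ?_
  rw [norm_mul, norm_inner_symm]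
  generalize ‖⟪b p.2, S (b p.1)⟫_ℂ‖ = x
  generalize ‖⟪b p.2, T (b p.1)⟫_ℂ‖ = y
  nlinarith [sq_nonneg (x - y), sq_nonneg x, sq_nonneg y]

/-- Cyclicity `tr (S* T) = tr (T S*)`: both are iterated sums of one absolutely summable double
series of matrix entries. The common limit `z` carries convergence along with equality. -/
theorem exists_hasSum_inner (hS : IsHilbertSchmidt b S) (hT : IsHilbertSchmidt b T) :
    ∃ z : ℂ, HasSum (fun i => ⟪S (b i), T (b i)⟫_ℂ) z ∧
      HasSum (fun i => ⟪T.adjoint (b i), S.adjoint (b i)⟫_ℂ) z := by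
  have hsum := hS.summable_inner_mul_inner hT
  obtain ⟨F, hF⟩ : ∃ F : ι × ι → ℂ,
      ∀ p, F p = ⟪S (b p.1), b p.2⟫_ℂ * ⟪b p.2, T (b p.1)⟫_ℂ := ⟨_, fun _ => rfl⟩
  have hFsum : HasSum F (∑' p, F p) := ((summable_congr hF).2 hsum).hasSum
  have h1 : ∀ i, HasSum (fun j => F (i, j)) ⟪S (b i), T (b i)⟫_ℂ := fun i => by
    have h := b.hasSum_inner_mul_inner (S (b i)) (T (b i))
    simp only [hF]
    exact h
  have h2 : ∀ j, HasSum (fun i => F (i, j)) ⟪T.adjoint (b j), S.adjoint (b j)⟫_ℂ := fun j => by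
    have h := b.hasSum_inner_mul_inner (T.adjoint (b j)) (S.adjoint (b j))
    have h3 : ∀ i, F (i, j) = ⟪T.adjoint (b j), b i⟫_ℂ * ⟪b i, S.adjoint (b j)⟫_ℂ := fun i => by
      rw [hF, ContinuousLinearMap.adjoint_inner_left, ContinuousLinearMap.adjoint_inner_right,
        mul_comm]
    simp only [h3]
    exact h
  have h3 : HasSum (fun p : ι × ι => F p.swap) (∑' p, F p) :=
    (Equiv.prodComm ι ι).hasSum_iff.2 hFsum
  exact ⟨∑' p, F p, hFsum.prod_fiberwise h1, h3.prod_fiberwise h2⟩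

end IsHilbertSchmidt

/-- A positive operator with summable diagonal. -/
def IsPositiveTraceClass (b : HilbertBasis ι ℂ E) (ρ : E →L[ℂ] E) : Prop :=
  ρ.IsPositive ∧ Summable fun i => (⟪b i, ρ (b i)⟫_ℂ).re

theorem IsPositiveTraceClass.exists_vectors {b : HilbertBasis ι ℂ E} {ρ : E →L[ℂ] E}
    (hρ : IsPositiveTraceClass b ρ) :
    ∃ ψ : ι → E, (Summable fun i => ‖ψ i‖ ^ 2) ∧ ∀ B : E →L[ℂ] E,
      ∃ z, HasSum (fun i => ⟪b i, ρ (B (b i))⟫_ℂ) z ∧ HasSum (fun i => ⟪ψ i, B (ψ i)⟫_ℂ) z := by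
  obtain ⟨hpos, hsum⟩ := hρ
  have h0 : 0 ≤ ρ := (ContinuousLinearMap.nonneg_iff_isPositive ρ).2 hpos
  set S : E →L[ℂ] E := CFC.sqrt ρ with hSdef
  have hSS : ∀ x, S (S x) = ρ x := fun x => by
    have := CFC.sqrt_mul_sqrt_self ρ h0
    exact congr($this x)
  have hadj : S.adjoint = S := by
    have : 0 ≤ S := CFC.sqrt_nonneg ρ
    exact this.isSelfAdjoint.star_eq
  have hmove : ∀ x y, ⟪S x, y⟫_ℂ = ⟪x, S y⟫_ℂ := fun x y => by
    conv_rhs => rw [← hadj]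
    rw [ContinuousLinearMap.adjoint_inner_right]
  have hS : IsHilbertSchmidt b S := by
    refine hsum.congr fun i => ?_
    rw [← hSS, ← hmove]
    exact (inner_self_eq_norm_sq (𝕜 := ℂ) _)
  refine ⟨fun i => S (b i), hS, fun B => ?_⟩
  -- Cyclicity for the factors `S` and `S B`: `tr (S S B) = tr (S B S)`.
  obtain ⟨z, h1, h2⟩ := hS.exists_hasSum_inner (hS.comp_right B)
  refine ⟨z, ?_, ?_⟩
  · simpa only [hmove, ContinuousLinearMap.comp_apply, hSS] using h1
  · simpa only [ContinuousLinearMap.adjoint_comp, hadj, ContinuousLinearMap.comp_apply,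
      ContinuousLinearMap.adjoint_inner_left] using h2

end HilbertSchmidt

/-! ### Quadrature densities of vector states. -/

section Densities

theorem coeFn_expQuadrature (μ ν t : ℝ) (ψ : H) :
    expQuadrature μ ν t ψ =ᵐ[volume] expQuadratureFun μ ν t ψ :=
  MemLp.coeFn_toLp (memLp_expQuadratureFun μ ν t ψ)

theorem expQuadrature_zero (μ ν : ℝ) (ψ : H) : expQuadrature μ ν 0 ψ = ψ := by
  refine Lp.ext ((coeFn_expQuadrature μ ν 0 ψ).trans ?_)
  rw [expQuadratureFun_zero]

theorem integrable_norm_sq (ψ : H) : Integrable fun y => ‖ψ y‖ ^ 2 :=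
  (memLp_two_iff_integrable_sq_norm (Lp.aestronglyMeasurable ψ)).1 (Lp.memLp ψ)

theorem exists_density_position (μ : ℝ) (hμ : μ ≠ 0) (ψ : H) :
    ∃ w : ℝ → ℝ, (∀ x, 0 ≤ w x) ∧ Integrable w ∧ ∀ t : ℝ,
      ∫ x, Complex.exp (((t * x : ℝ) : ℂ) * Complex.I) * (w x : ℂ)
        = ⟪ψ, expQuadrature μ 0 t ψ⟫_ℂ := by
  -- The density of `|ψ|²` pushed forward along `y ↦ μ y`.
  refine ⟨fun x => |μ⁻¹| * ‖ψ (μ⁻¹ * x)‖ ^ 2, fun x => by positivity,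
    (((integrable_comp_mul_left_iff _ (inv_ne_zero hμ)).2 (integrable_norm_sq ψ)).const_mul _),
    fun t => ?_⟩
  have h := Measure.integral_comp_mul_left (fun y : ℝ =>
    Complex.exp (((t * (μ * y) : ℝ) : ℂ) * Complex.I) * ((‖ψ y‖ ^ 2 : ℝ) : ℂ)) μ⁻¹
  have h' : ∫ x, Complex.exp (((t * x : ℝ) : ℂ) * Complex.I) *
      ((|μ⁻¹| * ‖ψ (μ⁻¹ * x)‖ ^ 2 : ℝ) : ℂ) = (|μ⁻¹| : ℝ) *
      ∫ x, Complex.exp (((t * (μ * (μ⁻¹ * x)) : ℝ) : ℂ) * Complex.I) *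
        ((‖ψ (μ⁻¹ * x)‖ ^ 2 : ℝ) : ℂ) := by
    rw [← integral_const_mul]
    refine integral_congr_ae (Filter.Eventually.of_forall fun x => ?_)
    simp only [mul_inv_cancel_left₀ hμ]
    push_cast; ring
  rw [h', h, inv_inv, Complex.real_smul, ← mul_assoc, ← Complex.ofReal_mul, ← abs_mul,
    inv_mul_cancel₀ hμ, abs_one, Complex.ofReal_one, one_mul, L2.inner_def]
  refine integral_congr_ae ?_
  filter_upwards [coeFn_expQuadrature μ 0 t ψ] with y hy
  rw [hy, expQuadratureFun, phase, RCLike.inner_apply, mul_zero, mul_zero, zero_div, add_zero,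
    add_zero, mul_assoc, Complex.mul_conj, Complex.normSq_eq_norm_sq, mul_assoc t μ y]

/-- The Fourier transform of `L²` turns translations into modulations. -/
theorem fourier_expQuadrature (ν t : ℝ) (ψ : H) :
    FourierTransform.fourier (expQuadrature 0 ν t ψ)
      = expQuadrature (2 * Real.pi * ν) 0 t (FourierTransform.fourier ψ : H) := by
  -- Both sides are continuous in `ψ`, so Schwartz functions suffice; there the Fourier transform is
  -- an integral. The factor `2π` comes from the normalisation of `Real.fourierChar`.
  refine DenseRange.induction_on (SchwartzMap.denseRange_toLpCLM (E := ℝ) (F := ℂ) (p := 2)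
    (μ := volume) ENNReal.ofNat_ne_top) ψ (isClosed_eq ?_ ?_) fun f => ?_
  · exact (Lp.fourierTransformₗᵢ ℝ ℂ).continuous.comp (expQuadrature 0 ν t).continuous
  · exact (expQuadrature _ 0 t).continuous.comp (Lp.fourierTransformₗᵢ ℝ ℂ).continuous
  · change FourierTransform.fourier (expQuadrature 0 ν t (f.toLp 2)) =
      expQuadrature (2 * Real.pi * ν) 0 t (FourierTransform.fourier (f.toLp 2))
    have h1 : expQuadrature 0 ν t (f.toLp 2)
        = (f.compSubConstCLM ℂ (-(t * ν))).toLp 2 := by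
      refine Lp.ext ((coeFn_expQuadrature 0 ν t _).trans ?_)
      refine (expQuadratureFun_congr 0 ν t (f.coeFn_toLp 2)).trans ?_
      filter_upwards [(f.compSubConstCLM ℂ (-(t * ν))).coeFn_toLp 2] with y hy
      rw [hy]
      simp [expQuadratureFun, phase]
    rw [h1, SchwartzMap.toLp_fourier_eq, SchwartzMap.toLp_fourier_eq]
    refine Lp.ext ?_
    filter_upwards [SchwartzMap.coeFn_toLp
      (FourierTransform.fourier (f.compSubConstCLM ℂ (-(t * ν)))) 2,
      coeFn_expQuadrature (2 * Real.pi * ν) 0 t ((FourierTransform.fourier f).toLp 2),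
      expQuadratureFun_congr (2 * Real.pi * ν) 0 t
        (SchwartzMap.coeFn_toLp (FourierTransform.fourier f) 2)] with y h2 h3 h4
    rw [h2, h3, h4, SchwartzMap.fourier_coe, SchwartzMap.fourier_coe]
    have h5 : ⇑(f.compSubConstCLM ℂ (-(t * ν))) = f ∘ fun v => v + t * ν := by
      funext v; simp
    rw [h5]
    refine (congrFun (VectorFourier.fourierIntegral_comp_add_right Real.fourierChar volume
      (innerₗ ℝ) f (t * ν)) y).trans ?_
    rw [expQuadratureFun, mul_zero, add_zero, Circle.smul_def, Real.fourierChar_apply, phase]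
    change _ • FourierTransform.fourier (⇑f) y = _
    rw [smul_eq_mul]
    congr 3
    simp
    ring

theorem exists_density_momentum (ν : ℝ) (hν : ν ≠ 0) (ψ : H) :
    ∃ w : ℝ → ℝ, (∀ x, 0 ≤ w x) ∧ Integrable w ∧ ∀ t : ℝ,
      ∫ x, Complex.exp (((t * x : ℝ) : ℂ) * Complex.I) * (w x : ℂ)
        = ⟪ψ, expQuadrature 0 ν t ψ⟫_ℂ := by
  obtain ⟨w, h0, hint, hw⟩ := exists_density_position (2 * Real.pi * ν) (by positivity)
    (FourierTransform.fourier ψ : H)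
  refine ⟨w, h0, hint, fun t => ?_⟩
  rw [hw, ← fourier_expQuadrature, Lp.inner_fourier_eq]

/-- The gauge transformation `f ↦ exp(i μ y² / (2 ν)) f` removes the position part. -/
theorem exists_gauge (μ ν : ℝ) (hν : ν ≠ 0) (ψ : H) :
    ∃ χ : H, ∀ t, ⟪ψ, expQuadrature μ ν t ψ⟫_ℂ = ⟪χ, expQuadrature 0 ν t χ⟫_ℂ := by
  set g : ℝ → ℂ := fun y => Complex.exp (((μ * y ^ 2 / (2 * ν) : ℝ) : ℂ) * Complex.I) with hg
  have hgc : Continuous g := by fun_prop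
  have hmem : MemLp (fun y => g y * ψ y) 2 (volume : Measure ℝ) := by
    refine (Lp.memLp ψ).of_le (hgc.aestronglyMeasurable.mul (Lp.aestronglyMeasurable ψ)) ?_
    exact Filter.Eventually.of_forall fun y => by
      rw [norm_mul, hg, Complex.norm_exp_ofReal_mul_I, one_mul]
  refine ⟨hmem.toLp _, fun t => ?_⟩
  rw [L2.inner_def, L2.inner_def]
  refine integral_congr_ae ?_
  filter_upwards [coeFn_expQuadrature μ ν t ψ, coeFn_expQuadrature 0 ν t (hmem.toLp _),
    hmem.coeFn_toLp, expQuadratureFun_congr 0 ν t hmem.coeFn_toLp] with y h1 h2 h3 h4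
  rw [h1, h2, h3, h4]
  simp only [expQuadratureFun, phase, RCLike.inner_apply, map_mul, hg, ← Complex.exp_conj,
    Complex.conj_ofReal, Complex.conj_I]
  -- Completing the square: `t μ y + t² μ ν / 2 = μ ((y + t ν)² - y²) / (2 ν)`.
  have key : Complex.exp (((t * μ * y + t ^ 2 * μ * ν / 2 : ℝ) : ℂ) * Complex.I)
      = Complex.exp (((t * 0 * y + t ^ 2 * 0 * ν / 2 : ℝ) : ℂ) * Complex.I) *
        Complex.exp (((μ * (y + t * ν) ^ 2 / (2 * ν) : ℝ) : ℂ) * Complex.I) *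
        Complex.exp (((μ * y ^ 2 / (2 * ν) : ℝ) : ℂ) * -Complex.I) := by
    rw [← Complex.exp_add, ← Complex.exp_add]
    congr 1
    have hν' : (ν : ℂ) ≠ 0 := by exact_mod_cast hν
    push_cast
    field_simp
    ring
  rw [key]
  ring

theorem exists_density (μ ν : ℝ) (hμν : (μ, ν) ≠ (0, 0)) (ψ : H) :
    ∃ w : ℝ → ℝ, (∀ x, 0 ≤ w x) ∧ Integrable w ∧ ∀ t : ℝ,
      ∫ x, Complex.exp (((t * x : ℝ) : ℂ) * Complex.I) * (w x : ℂ)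
        = ⟪ψ, expQuadrature μ ν t ψ⟫_ℂ := by
  by_cases hν : ν = 0
  · subst hν
    exact exists_density_position μ (fun h => hμν (by rw [h])) ψ
  · obtain ⟨χ, hχ⟩ := exists_gauge μ ν hν ψ
    simpa only [hχ] using exists_density_momentum ν hν χ

end Densities

/-! ### Finiteness of the trace norm and the Jordan decomposition. -/

section TraceNorm

variable {E : Type*} [NormedAddCommGroup E] [InnerProductSpace ℂ E] [CompleteSpace E]

theorem IsDensityOperator.isPositiveTraceClass {ρ : E →L[ℂ] E} (h : IsDensityOperator ρ) :
    IsPositiveTraceClass (onb E) ρ :=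
  ⟨h.1, ((Complex.hasSum_iff _ _).1 h.2).1.summable⟩

omit [CompleteSpace E] in
theorem re_inner_nonneg_of_isPositive {ρ : E →L[ℂ] E} (h : ρ.IsPositive) (x : E) :
    0 ≤ (⟪x, ρ x⟫_ℂ).re :=
  h.re_inner_nonneg_right x

theorem IsPositiveTraceClass.summable_inner_comp {ι : Type*} {b : HilbertBasis ι ℂ E}
    {ρ : E →L[ℂ] E} (h : IsPositiveTraceClass b ρ) (B : E →L[ℂ] E) :
    Summable fun i => ⟪b i, ρ (B (b i))⟫_ℂ := by
  obtain ⟨ψ, -, hψ⟩ := h.exists_vectors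
  obtain ⟨z, hz, -⟩ := hψ B
  exact hz.summable

/-- `|tr (ρ B)| ≤ ‖B‖ tr ρ` for positive trace class `ρ`. -/
theorem IsPositiveTraceClass.norm_trace_comp_le {ρ : E →L[ℂ] E}
    (h : IsPositiveTraceClass (onb E) ρ) (B : E →L[ℂ] E) :
    ‖trace (ρ ∘L B)‖ ≤ ‖B‖ * (trace ρ).re := by
  obtain ⟨ψ, hs, hψ⟩ := h.exists_vectors
  obtain ⟨z, hz, hz'⟩ := hψ B
  obtain ⟨y, hy, hy'⟩ := hψ (ContinuousLinearMap.id ℂ E)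
  have h1 : trace (ρ ∘L B) = z := hz.tsum_eq
  have h2 : trace ρ = y := hy.tsum_eq
  have h3 : y.re = ∑' i, ‖ψ i‖ ^ 2 := by
    rw [← ((Complex.hasSum_iff _ _).1 hy').1.tsum_eq]
    exact tsum_congr fun i => inner_self_eq_norm_sq (𝕜 := ℂ) _
  rw [h1, h2, h3, ← tsum_mul_left, ← hz'.tsum_eq]
  refine tsum_of_norm_bounded (hs.mul_left _).hasSum fun i => ?_
  calc ‖⟪ψ i, B (ψ i)⟫_ℂ‖ ≤ ‖ψ i‖ * ‖B (ψ i)‖ := norm_inner_le_norm _ _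
    _ ≤ ‖ψ i‖ * (‖B‖ * ‖ψ i‖) := by gcongr; exact B.le_opNorm _
    _ = _ := by ring

theorem trace_sub_comp {ρ₁ ρ₂ : E →L[ℂ] E} (h₁ : IsPositiveTraceClass (onb E) ρ₁)
    (h₂ : IsPositiveTraceClass (onb E) ρ₂) (B : E →L[ℂ] E) :
    HasSum (fun i => ⟪onb E i, ((ρ₁ - ρ₂) ∘L B) (onb E i)⟫_ℂ)
      (trace (ρ₁ ∘L B) - trace (ρ₂ ∘L B)) := by
  have h := (h₁.summable_inner_comp B).hasSum.sub (h₂.summable_inner_comp B).hasSum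
  simp only [← inner_sub_right] at h
  exact h

/-- The function `x / (|x| + ε)` is a continuous substitute for the sign, so the continuous
functional calculus suffices. The error is `|x| - x² / (|x| + ε) = ε |x| / (|x| + ε) ≤ ε`. -/
theorem exists_near_abs {A : E →L[ℂ] E} (hA : IsSelfAdjoint A) {ε : ℝ} (hε : 0 < ε) :
    ∃ B : E →L[ℂ] E, ‖B‖ ≤ 1 ∧ (A ∘L B).IsPositive ∧ ‖CFC.abs A - A ∘L B‖ ≤ ε := by
  have hpos : ∀ x : ℝ, 0 < |x| + ε := fun x => by positivity
  have hne : ∀ x : ℝ, |x| + ε ≠ 0 := fun x => (hpos x).ne'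
  have hc : Continuous fun x : ℝ => x / (|x| + ε) :=
    continuous_id.div (by fun_prop) hne
  have hmul : A * cfc (fun x : ℝ => x / (|x| + ε)) A
      = cfc (fun x : ℝ => x * (x / (|x| + ε))) A := by
    rw [cfc_mul (fun x : ℝ => x) _ A (by fun_prop) hc.continuousOn, cfc_id' ℝ A]
  refine ⟨cfc (fun x : ℝ => x / (|x| + ε)) A, ?_, ?_, ?_⟩
  · refine norm_cfc_le zero_le_one fun x _ => ?_
    rw [Real.norm_eq_abs, abs_div, abs_of_pos (hpos x), div_le_one (hpos x)]
    linarith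
  · rw [← ContinuousLinearMap.nonneg_iff_isPositive]
    change 0 ≤ A * cfc (fun x : ℝ => x / (|x| + ε)) A
    rw [hmul]
    refine cfc_nonneg fun x _ => ?_
    rw [mul_div_assoc']
    exact div_nonneg (mul_self_nonneg x) (hpos x).le
  · change ‖CFC.abs A - A * cfc (fun x : ℝ => x / (|x| + ε)) A‖ ≤ ε
    rw [hmul, CFC.abs_eq_cfc_norm A hA,
      ← cfc_sub (fun x : ℝ => ‖x‖) (fun x : ℝ => x * (x / (|x| + ε))) A (by fun_prop)
        (continuous_id.mul hc).continuousOn]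
    refine norm_cfc_le hε.le fun x _ => ?_
    have h1 : ‖x‖ - x * (x / (|x| + ε)) = ε * (|x| / (|x| + ε)) := by
      rw [Real.norm_eq_abs]
      field_simp [hne x]
      rw [← sq_abs x]; ring
    rw [h1, Real.norm_of_nonneg (by positivity)]
    refine mul_le_of_le_one_right hε.le ?_
    rw [div_le_one (hpos x)]
    linarith

/-- For a fixed finite set `F` of basis vectors, replacing `|A|` by `A B` costs at most `ε` per
vector, while `tr (A B) ≤ tr ρ₁ + tr ρ₂` uniformly in `ε`. Letting `ε → 0` bounds every partial sum.
-/
theorem isPositiveTraceClass_abs_sub {ρ₁ ρ₂ : E →L[ℂ] E}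
    (h₁ : IsPositiveTraceClass (onb E) ρ₁) (h₂ : IsPositiveTraceClass (onb E) ρ₂) :
    IsPositiveTraceClass (onb E) (CFC.abs (ρ₁ - ρ₂)) := by
  set A := ρ₁ - ρ₂ with hAdef
  have hA : IsSelfAdjoint A := h₁.1.isSelfAdjoint.sub h₂.1.isSelfAdjoint
  have habs : (CFC.abs A).IsPositive :=
    (ContinuousLinearMap.nonneg_iff_isPositive _).1 (CFC.abs_nonneg A)
  refine ⟨habs, summable_of_sum_le (c := (trace ρ₁).re + (trace ρ₂).re)
    (fun i => re_inner_nonneg_of_isPositive habs _) fun F => ?_⟩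
  have key : ∀ ε : ℝ, 0 < ε → ∑ i ∈ F, (⟪onb E i, CFC.abs A (onb E i)⟫_ℂ).re
      ≤ (trace ρ₁).re + (trace ρ₂).re + F.card * ε := fun ε hε => by
    obtain ⟨B, hB, hpos, hnear⟩ := exists_near_abs hA hε
    have hs := ((Complex.hasSum_iff _ _).1 (trace_sub_comp h₁ h₂ B)).1
    have hle := sum_le_hasSum F (fun i _ => re_inner_nonneg_of_isPositive hpos (onb E i)) hs
    have hb : ∀ {ρ : E →L[ℂ] E}, IsPositiveTraceClass (onb E) ρ →
        ‖trace (ρ ∘L B)‖ ≤ (trace ρ).re := fun {ρ} h => by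
      refine (h.norm_trace_comp_le B).trans (mul_le_of_le_one_left ?_ hB)
      -- The bound with `B = id` yields `0 ≤ tr ρ`: a negative real part would force `‖tr ρ‖ ≤ 0`.
      have h0 := h.norm_trace_comp_le (ContinuousLinearMap.id ℂ E)
      by_contra hneg
      have h1 : trace (ρ ∘L ContinuousLinearMap.id ℂ E) = trace ρ := rfl
      rw [h1] at h0
      have h2 := mul_nonneg (norm_nonneg (ContinuousLinearMap.id ℂ E)) (neg_nonneg.2 (not_le.1 hneg).le)
      have h3 : ‖trace ρ‖ ≤ 0 := by linarith
      rw [norm_le_zero_iff] at h3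
      simp [h3] at hneg
    have hterm : ∀ i, (⟪onb E i, CFC.abs A (onb E i)⟫_ℂ).re
        ≤ (⟪onb E i, (A ∘L B) (onb E i)⟫_ℂ).re + ε := fun i => by
      have h3 : ‖⟪onb E i, (CFC.abs A - A ∘L B) (onb E i)⟫_ℂ‖ ≤ ε := by
        refine (norm_inner_le_norm _ _).trans ?_
        have hn : ‖onb E i‖ = 1 := (onb E).orthonormal.1 i
        rw [hn, one_mul]
        refine (ContinuousLinearMap.le_opNorm _ _).trans ?_
        rwa [hn, mul_one]
      have h4 := (Complex.re_le_norm _).trans h3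
      rw [sub_apply, inner_sub_right, Complex.sub_re] at h4
      linarith
    have hr : (trace (ρ₁ ∘L B) - trace (ρ₂ ∘L B)).re ≤ (trace ρ₁).re + (trace ρ₂).re :=
      (Complex.re_le_norm _).trans ((norm_sub_le _ _).trans (add_le_add (hb h₁) (hb h₂)))
    calc _ ≤ ∑ i ∈ F, ((⟪onb E i, (A ∘L B) (onb E i)⟫_ℂ).re + ε) :=
          Finset.sum_le_sum fun i _ => hterm i
      _ = ∑ i ∈ F, (⟪onb E i, (A ∘L B) (onb E i)⟫_ℂ).re + F.card * ε := by
          rw [Finset.sum_add_distrib, Finset.sum_const, nsmul_eq_mul]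
      _ ≤ _ := by
          have := hle.trans hr
          gcongr
  refine le_of_forall_pos_le_add fun δ hδ => ?_
  -- The `+ 1` keeps the denominator positive when `F` is empty.
  refine (key (δ / (F.card + 1)) (by positivity)).trans ?_
  gcongr
  rw [mul_div_assoc', div_le_iff₀ (by positivity)]
  nlinarith

theorem traceNorm_eq_ofReal {A : E →L[ℂ] E} (h : IsPositiveTraceClass (onb E) (CFC.abs A)) :
    traceNorm A = ENNReal.ofReal (trace (CFC.abs A)).re := by
  rw [traceNorm, ← ENNReal.ofReal_tsum_of_nonneg (fun i => re_inner_nonneg_of_isPositive h.1 _) h.2, trace,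
    Complex.re_tsum]
  exact h.summable_inner_comp (ContinuousLinearMap.id ℂ E)

omit [CompleteSpace E] in
theorem IsPositiveTraceClass.of_add {ι : Type*} {b : HilbertBasis ι ℂ E} {ρ σ τ : E →L[ℂ] E}
    (h : IsPositiveTraceClass b τ) (hρ : ρ.IsPositive) (hσ : σ.IsPositive) (hτ : ρ + σ = τ) :
    IsPositiveTraceClass b ρ := by
  refine ⟨hρ, Summable.of_nonneg_of_le (fun i => re_inner_nonneg_of_isPositive hρ _) (fun i => ?_) h.2⟩
  rw [← hτ, add_apply, inner_add_right, Complex.add_re]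
  exact le_add_of_nonneg_right (re_inner_nonneg_of_isPositive hσ (b i))

/-- The Jordan decomposition of a difference of positive trace class operators computes its trace
norm. -/
theorem exists_jordan_decomposition {ρ₁ ρ₂ : E →L[ℂ] E}
    (h₁ : IsPositiveTraceClass (onb E) ρ₁) (h₂ : IsPositiveTraceClass (onb E) ρ₂) :
    ∃ P N : E →L[ℂ] E, IsPositiveTraceClass (onb E) P ∧ IsPositiveTraceClass (onb E) N ∧
      ρ₁ + N = ρ₂ + P ∧ traceNorm (ρ₁ - ρ₂) = ENNReal.ofReal (trace (P + N)).re := by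
  have habs := isPositiveTraceClass_abs_sub h₁ h₂
  have hA : IsSelfAdjoint (ρ₁ - ρ₂) := h₁.1.isSelfAdjoint.sub h₂.1.isSelfAdjoint
  have hadd := CFC.posPart_add_negPart (ρ₁ - ρ₂) hA
  have hsub := CFC.posPart_sub_negPart (ρ₁ - ρ₂) hA
  have hp := (ContinuousLinearMap.nonneg_iff_isPositive _).1 (CFC.posPart_nonneg (ρ₁ - ρ₂))
  have hn := (ContinuousLinearMap.nonneg_iff_isPositive _).1 (CFC.negPart_nonneg (ρ₁ - ρ₂))
  refine ⟨_, _, habs.of_add hp hn hadd, habs.of_add hn hp ((add_comm _ _).trans hadd), ?_,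
    hadd.symm ▸ traceNorm_eq_ofReal habs⟩
  rw [eq_add_of_sub_eq hsub]
  abel

end TraceNorm

/-! ### Existence, uniqueness and additivity of tomograms; the comparison. -/

section Tomograms

theorem exists_tsum_density {ι : Type*} [Countable ι] {w : ι → ℝ → ℝ} (h0 : ∀ i x, 0 ≤ w i x)
    (hint : ∀ i, Integrable (w i)) (hsum : Summable fun i => ∫ x, w i x) :
    ∃ W : ℝ → ℝ, (∀ x, 0 ≤ W x) ∧ Integrable W ∧ ∀ g : ℝ → ℂ, Continuous g → (∀ x, ‖g x‖ ≤ 1) →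
      HasSum (fun i => ∫ x, g x * (w i x : ℂ)) (∫ x, g x * (W x : ℂ)) := by
  -- Summing in `[0, ∞]` avoids pointwise convergence questions; the finite integral makes the sum
  -- finite almost everywhere.
  set F : ℝ → ℝ≥0∞ := fun x => ∑' i, ENNReal.ofReal (w i x) with hF
  have hmeas : ∀ i, AEMeasurable (fun x => ENNReal.ofReal (w i x)) :=
    fun i => (hint i).1.aemeasurable.ennreal_ofReal
  have hFm : AEMeasurable F := AEMeasurable.tsum hmeas
  have hFint : ∫⁻ x, F x ≠ ⊤ := by
    rw [lintegral_tsum hmeas]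
    simp only [← ofReal_integral_eq_lintegral_ofReal (hint _) (ae_of_all _ (h0 _))]
    exact hsum.tsum_ofReal_ne_top
  refine ⟨fun x => (F x).toReal, fun x => ENNReal.toReal_nonneg,
    integrable_toReal_of_lintegral_ne_top hFm hFint, fun g hg hg1 => ?_⟩
  have hgint : ∀ i, Integrable fun x => g x * (w i x : ℂ) := fun i =>
    (hint i).ofReal.bdd_mul hg.aestronglyMeasurable (ae_of_all _ hg1)
  have h := hasSum_integral_of_summable_integral_norm hgint (by
    refine Summable.of_nonneg_of_le (fun i => integral_nonneg fun x => norm_nonneg _)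
      (fun i => integral_mono (hgint i).norm (hint i) fun x => ?_) hsum
    simp only [norm_mul, Complex.norm_real, Real.norm_of_nonneg (h0 i x)]
    exact mul_le_of_le_one_left (h0 i x) (hg1 x))
  refine (integral_congr_ae ?_ : _ = ∫ x, g x * ((F x).toReal : ℂ)) ▸ h
  filter_upwards [ae_lt_top' hFm hFint] with x hx
  rw [tsum_mul_left, ← Complex.ofReal_tsum, hF, ENNReal.tsum_toReal_eq fun i => ENNReal.ofReal_ne_top]
  simp only [ENNReal.toReal_ofReal (h0 _ _)]

theorem exists_isTomogram {ρ : H →L[ℂ] H} (hρ : IsPositiveTraceClass (onb H) ρ) (μ ν : ℝ)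
    (hμν : (μ, ν) ≠ (0, 0)) : ∃ w, IsTomogram ρ μ ν w := by
  obtain ⟨ψ, hs, hψ⟩ := hρ.exists_vectors
  choose w h0 hint hw using fun i => exists_density μ ν hμν (ψ i)
  have hnorm : ∀ i, ∫ x, w i x = ‖ψ i‖ ^ 2 := fun i => by
    -- At `t = 0` the Fourier identity gives the total mass.
    have h := hw i 0
    rw [expQuadrature_zero, inner_self_eq_norm_sq_to_K] at h
    simp only [zero_mul, Complex.ofReal_zero, Complex.exp_zero, one_mul, integral_complex_ofReal]
      at h
    exact Complex.ofReal_injective (h.trans (Complex.ofReal_pow _ _).symm)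
  -- Measurability of the summed density needs a countable index set; summability leaves only
  -- countably many nonzero `ψᵢ`.
  have hc : Countable (Function.support fun i => ‖ψ i‖ ^ 2) := hs.countable_support.to_subtype
  obtain ⟨W, hW0, hWint, hW⟩ := exists_tsum_density
    (w := fun i : Function.support fun i => ‖ψ i‖ ^ 2 => w i) (fun i => h0 i) (fun i => hint i)
    (by simp only [hnorm]; exact hs.subtype _)
  refine ⟨W, hW0, hWint, fun t => ?_⟩
  have h := hW (fun x => Complex.exp (((t * x : ℝ) : ℂ) * Complex.I)) (by fun_prop)
    (fun x => (Complex.norm_exp_ofReal_mul_I _).le)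
  simp only [hw] at h
  have h' := (hasSum_subtype_iff_of_support_subset (s := Function.support fun i => ‖ψ i‖ ^ 2)
    (f := fun i => ⟪ψ i, expQuadrature μ ν t (ψ i)⟫_ℂ) (fun i hi hi' => hi (by
      have : ψ i = 0 := by simpa using hi'
      simp [this]))).1 h
  obtain ⟨z, hz, hz'⟩ := hψ (expQuadrature μ ν t)
  rw [h'.unique hz']
  exact hz.tsum_eq.symm

/-- Nonnegative integrable functions are determined by their characteristic functions. -/
theorem ae_eq_of_charFun_eq {v w : ℝ → ℝ} (hv0 : ∀ x, 0 ≤ v x) (hw0 : ∀ x, 0 ≤ w x)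
    (hv : Integrable v) (hw : Integrable w)
    (h : ∀ t : ℝ, ∫ x, Complex.exp (((t * x : ℝ) : ℂ) * Complex.I) * (v x : ℂ)
      = ∫ x, Complex.exp (((t * x : ℝ) : ℂ) * Complex.I) * (w x : ℂ)) : v =ᵐ[volume] w := by
  have hchar : ∀ {u : ℝ → ℝ}, (∀ x, 0 ≤ u x) → Integrable u → ∀ t,
      charFun (volume.withDensity fun x => ENNReal.ofReal (u x)) t
        = ∫ x, Complex.exp (((t * x : ℝ) : ℂ) * Complex.I) * (u x : ℂ) := fun {u} hu0 hu t => by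
    rw [charFun_apply_real, integral_withDensity_eq_integral_toReal_smul₀
      hu.1.aemeasurable.ennreal_ofReal (ae_of_all _ fun x => ENNReal.ofReal_lt_top)]
    refine integral_congr_ae (ae_of_all _ fun x => ?_)
    simp only [ENNReal.toReal_ofReal (hu0 x), Complex.real_smul, Complex.ofReal_mul]
    ring
  have : IsFiniteMeasure (volume.withDensity fun x => ENNReal.ofReal (v x)) :=
    isFiniteMeasure_withDensity_ofReal hv.2
  have : IsFiniteMeasure (volume.withDensity fun x => ENNReal.ofReal (w x)) :=
    isFiniteMeasure_withDensity_ofReal hw.2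
  have heq : (volume.withDensity fun x => ENNReal.ofReal (v x))
      = volume.withDensity fun x => ENNReal.ofReal (w x) :=
    Measure.ext_of_charFun (funext fun t => by rw [hchar hv0 hv, hchar hw0 hw, h])
  have hae := (withDensity_eq_iff hv.1.aemeasurable.ennreal_ofReal
    hw.1.aemeasurable.ennreal_ofReal hv.lintegral_lt_top.ne).1 heq
  filter_upwards [hae] with x hx
  exact (ENNReal.ofReal_eq_ofReal_iff (hv0 x) (hw0 x)).1 hx

theorem isTomogram_tomogram {ρ : H →L[ℂ] H} (hρ : IsPositiveTraceClass (onb H) ρ) (μ ν : ℝ)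
    (hμν : (μ, ν) ≠ (0, 0)) : IsTomogram ρ μ ν (tomogram ρ μ ν) := by
  have h := exists_isTomogram hρ μ ν hμν
  rw [tomogram, dif_pos h]
  exact h.choose_spec

theorem IsTomogram.add {ρ σ : H →L[ℂ] H} {μ ν : ℝ} {v w : ℝ → ℝ}
    (hv : IsTomogram ρ μ ν v) (hw : IsTomogram σ μ ν w) (hρ : IsPositiveTraceClass (onb H) ρ)
    (hσ : IsPositiveTraceClass (onb H) σ) : IsTomogram (ρ + σ) μ ν (v + w) := by
  refine ⟨fun x => add_nonneg (hv.1 x) (hw.1 x), hv.2.1.add hw.2.1, fun t => ?_⟩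
  have hint : ∀ {u : ℝ → ℝ}, Integrable u →
      Integrable fun x => Complex.exp (((t * x : ℝ) : ℂ) * Complex.I) * (u x : ℂ) := fun hu =>
    hu.ofReal.bdd_mul (by fun_prop) (ae_of_all _ fun x => (Complex.norm_exp_ofReal_mul_I _).le)
  have htr : trace ((ρ + σ) ∘L expQuadrature μ ν t)
      = trace (ρ ∘L expQuadrature μ ν t) + trace (σ ∘L expQuadrature μ ν t) := by
    have h := ((hρ.summable_inner_comp (expQuadrature μ ν t)).hasSum.add
      (hσ.summable_inner_comp (expQuadrature μ ν t)).hasSum)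
    simp only [← inner_add_right] at h
    exact h.tsum_eq
  rw [htr, ← hv.2.2, ← hw.2.2, ← integral_add (hint hv.2.1) (hint hw.2.1)]
  refine integral_congr_ae (ae_of_all _ fun x => ?_)
  simp only [Pi.add_apply, Complex.ofReal_add, mul_add]

theorem IsTomogram.ae_eq {ρ : H →L[ℂ] H} {μ ν : ℝ} {v w : ℝ → ℝ}
    (hv : IsTomogram ρ μ ν v) (hw : IsTomogram ρ μ ν w) : v =ᵐ[volume] w :=
  ae_eq_of_charFun_eq hv.1 hw.1 hv.2.1 hw.2.1 fun t => by rw [hv.2.2, hw.2.2]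

theorem IsTomogram.integral_eq {ρ : H →L[ℂ] H} {μ ν : ℝ} {w : ℝ → ℝ} (hw : IsTomogram ρ μ ν w) :
    ∫ x, w x = (trace ρ).re := by
  have h := hw.2.2 0
  have h1 : ρ ∘L expQuadrature μ ν 0 = ρ :=
    ContinuousLinearMap.ext fun ψ => congrArg ρ (expQuadrature_zero μ ν ψ)
  rw [h1] at h
  simp only [zero_mul, Complex.ofReal_zero, Complex.exp_zero, one_mul, integral_complex_ofReal] at h
  rw [← h, Complex.ofReal_re]

/-- Since `IsTomogram` requires nonnegative densities, the decomposition enters as the balance `ρ₁ +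
N = ρ₂ + P` between positive operators, not as a difference. -/
theorem integral_abs_sub_le {ρ₁ ρ₂ P N : H →L[ℂ] H} {μ ν : ℝ} {w₁ w₂ : ℝ → ℝ}
    (hμν : (μ, ν) ≠ (0, 0)) (h₁ : IsPositiveTraceClass (onb H) ρ₁)
    (h₂ : IsPositiveTraceClass (onb H) ρ₂) (hP : IsPositiveTraceClass (onb H) P)
    (hN : IsPositiveTraceClass (onb H) N) (hbal : ρ₁ + N = ρ₂ + P)
    (hw₁ : IsTomogram ρ₁ μ ν w₁) (hw₂ : IsTomogram ρ₂ μ ν w₂) :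
    ∫ x, |w₁ x - w₂ x| ≤ (trace (P + N)).re := by
  obtain ⟨v, hv⟩ := exists_isTomogram hP μ ν hμν
  obtain ⟨u, hu⟩ := exists_isTomogram hN μ ν hμν
  have hsum := hv.add hu hP hN
  have hw := hw₂.add hv h₂ hP
  rw [← hbal] at hw
  rw [← hsum.integral_eq]
  refine integral_mono_ae (hw₁.2.1.sub hw₂.2.1).abs hsum.2.1 ?_
  filter_upwards [(hw₁.add hu h₁ hN).ae_eq hw] with x hx
  simp only [Pi.add_apply] at hx ⊢
  have h1 := hv.1 x
  have h2 := hu.1 x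
  rw [abs_le]
  constructor <;> linarith

end Tomograms
end CVTomography

/-- For density operators `ρ₁`, `ρ₂` of a continuous-variable mode and a setting `(μ, ν) ≠ (0, 0)`,
the tomograms exist as probability densities, and their total variation distance is at most the
(finite) trace distance of the states. -/
theorem theorem2 (ρ₁ ρ₂ : CVTomography.H →L[ℂ] CVTomography.H)
    (h₁ : CVTomography.IsDensityOperator ρ₁) (h₂ : CVTomography.IsDensityOperator ρ₂)
    (μ ν : ℝ) (hμν : (μ, ν) ≠ (0, 0)) :
    CVTomography.IsTomogram ρ₁ μ ν (CVTomography.tomogram ρ₁ μ ν) ∧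
    CVTomography.IsTomogram ρ₂ μ ν (CVTomography.tomogram ρ₂ μ ν) ∧
    CVTomography.traceNorm (ρ₁ - ρ₂) ≠ ⊤ ∧
    CVTomography.totalVariation (CVTomography.tomogram ρ₁ μ ν) (CVTomography.tomogram ρ₂ μ ν)
      ≤ CVTomography.traceDistance ρ₁ ρ₂ := by
  have hρ₁ := h₁.isPositiveTraceClass
  have hρ₂ := h₂.isPositiveTraceClass
  have hw₁ := CVTomography.isTomogram_tomogram hρ₁ μ ν hμν
  have hw₂ := CVTomography.isTomogram_tomogram hρ₂ μ ν hμν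
  obtain ⟨P, N, hP, hN, hbal, hnorm⟩ := CVTomography.exists_jordan_decomposition hρ₁ hρ₂
  have hle := CVTomography.integral_abs_sub_le hμν hρ₁ hρ₂ hP hN hbal hw₁ hw₂
  refine ⟨hw₁, hw₂, hnorm ▸ ENNReal.ofReal_ne_top, ?_⟩
  -- Removing `ENNReal.ofReal` needs `tr (P + N) ≥ 0`, which holds because this trace dominates the
  -- integral of an absolute value.
  rw [CVTomography.totalVariation, CVTomography.traceDistance, hnorm, ENNReal.toReal_ofReal
    ((integral_nonneg fun x => abs_nonneg _).trans hle)]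
  gcongr
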